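/- Let $k\ge 1$ be an integer. Let $J^k(\mathbb R)$ be $\mathbb R^{k+2}$, with points written $(x,u_k,\dots,u_0)$, equipped with the group operation $$(x,u_k,\dots,u_0)\odot(y,v_k,\dots,v_0)=(x+y,w_k,\dots,w_0),\qquad w_s=u_s+v_s+\sum_{j=s+1}^{k}u_j\frac{y^{j-s}}{(j-s)!}\quad(0\le s\le k),$$ and with the Carnot--Carathéodory metric $d_{cc}$: $d_{cc}(p,q)$ is the infimum of the lengths of the horizontal curves from $p$ to $q$, where a curve $(x,u_k,\dots,u_0):[a,b]\to\mathbb R^{k+2}$ is horizontal if it is absolutely continuous and $u_j'=u_{j+1}x'$ almost everywhere for $j=0,\dots,k-1$, and its length is $\int_a^b\sqrt{(x')^2+(u_k')^2}$. For $f\in C^\infty(\mathbb R)$ put $j^k_x(f)=(x,f^{(k)}(x),\dots,f'(x),f(x))$, and for $t\in\mathbb R$ and $p=(x,u_k,\dots,u_0)\in J^k(\mathbb R)$ put $$J_{f,t}(p)=j^k_{x-t}(f),\qquad V_{f,t}(p)=p\odot j^k_{x-t}(f)^{-1},$$ so that $p=V_{f,t}(p)\odot J_{f,t}(p)$ and $V_{f,t}(p)\in\{x=t\}:=\{(x,u_k,\dots,u_0)\in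 J^k(\mathbb R):x=t\}$. Then for every $t\in\mathbb R$ and every real $\beta$ with $0\le\beta\le\frac{(k+1)(k+2)}{2}$ there is a compact set $E_{t,\beta}\subset\{x=t\}$ such that for all $f\in C^\infty(\mathbb R)$, $$\dim_{H}V_{f,t}(E_{t,\beta})=\beta\qquad\text{and}\qquad\dim_{H}J_{f,t}(E_{t,\beta})=0,$$ where $\dim_H$ is the Hausdorff dimension with respect to $d_{cc}$. -/

import Mathlib

open MeasureTheory Set
open scoped ENNReal ContDiff

/-- The jet space `J^k(ℝ)`, identified with `ℝ^(k+2)`: a point is `(x, u_k, …, u_0)`, where `u j` is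
the coordinate `u_j` for `j = 0, …, k`. -/
@[ext]
structure JetSpace (k : ℕ) where
  x : ℝ
  u : Fin (k + 1) → ℝ

namespace JetSpace

variable {k : ℕ}

/-! ### The group structure -/

/-- `(x, u_k, …, u_0) ⊙ (y, v_k, …, v_0) = (x + y, w_k, …, w_0)` with
`w_s = u_s + v_s + ∑_{j = s+1}^k u_j y^(j-s) / (j-s)!`. -/
noncomputable instance : Mul (JetSpace k) where
  mul p q :=
    { x := p.x + q.x
      u := fun s => p.u s + q.u s
        + ∑ j ∈ Finset.Ioi s, p.u j * (q.x ^ ((j : ℕ) - s) / (Nat.factorial ((j : ℕ) - s) : ℝ)) }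

instance : One (JetSpace k) where
  one := { x := 0, u := fun _ => 0 }

noncomputable instance : Inv (JetSpace k) where
  inv p :=
    { x := -p.x
      u := fun s => -∑ j ∈ Finset.Ici s,
        p.u j * ((-p.x) ^ ((j : ℕ) - s) / (Nat.factorial ((j : ℕ) - s) : ℝ)) }

/-- Auxiliary: the Taylor shift of the coefficients `u` by `y`. -/
noncomputable def taylorShift (y : ℝ) (u : Fin (k + 1) → ℝ) (s : Fin (k + 1)) : ℝ :=
  ∑ j ∈ Finset.Ici s, u j * (y ^ ((j : ℕ) - s) / (Nat.factorial ((j : ℕ) - s) : ℝ))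

theorem taylorShift_zero (u : Fin (k + 1) → ℝ) (s : Fin (k + 1)) : taylorShift 0 u s = u s := by
  unfold taylorShift
  rw [Finset.sum_eq_single s]
  · simp
  · intro j hj hjs
    have hlt : s < j := lt_of_le_of_ne (Finset.mem_Ici.mp hj) (Ne.symm hjs)
    have h1 : (j : ℕ) - s ≠ 0 := by
      have : (s : ℕ) < j := hlt
      omega
    simp [h1]
  · intro h
    simp at h

theorem sum_Icc_pow_div_factorial (y z : ℝ) {s i : Fin (k + 1)} (hsi : s ≤ i) :
    ∑ j ∈ Finset.Icc s i, (y ^ ((i : ℕ) - j) / (Nat.factorial ((i : ℕ) - j) : ℝ))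
        * (z ^ ((j : ℕ) - s) / (Nat.factorial ((j : ℕ) - s) : ℝ))
      = (y + z) ^ ((i : ℕ) - s) / (Nat.factorial ((i : ℕ) - s) : ℝ) := by
  have hsi' : (s : ℕ) ≤ i := hsi
  rw [add_comm y z, add_pow, Finset.sum_div]
  refine Finset.sum_bij (fun j _ => (j : ℕ) - s) ?_ ?_ ?_ ?_
  · intro j hj
    have h := Finset.mem_Icc.mp hj
    have h1 : (s : ℕ) ≤ j := h.1
    have h2 : (j : ℕ) ≤ i := h.2
    rw [Finset.mem_range]
    omega
  · intro j hj j' hj' heq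
    have h1 : (s : ℕ) ≤ j := (Finset.mem_Icc.mp hj).1
    have h2 : (s : ℕ) ≤ j' := (Finset.mem_Icc.mp hj').1
    apply Fin.ext
    omega
  · intro m hm
    rw [Finset.mem_range] at hm
    have hlt : (s : ℕ) + m < k + 1 := by
      have := i.isLt
      omega
    refine ⟨⟨(s : ℕ) + m, hlt⟩, ?_, ?_⟩
    · rw [Finset.mem_Icc, Fin.le_def, Fin.le_def]
      dsimp only
      omega
    · dsimp only
      omega
  · intro j hj
    have h1 : (s : ℕ) ≤ j := (Finset.mem_Icc.mp hj).1
    have h2 : (j : ℕ) ≤ i := (Finset.mem_Icc.mp hj).2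
    have h3 : (i : ℕ) - s - ((j : ℕ) - s) = (i : ℕ) - j := by omega
    have h4 : (j : ℕ) - s ≤ (i : ℕ) - s := by omega
    rw [h3, Nat.cast_choose ℝ h4, h3]
    have e1 : (Nat.factorial ((i : ℕ) - s) : ℝ) ≠ 0 := by positivity
    have e2 : (Nat.factorial ((j : ℕ) - s) : ℝ) ≠ 0 := by positivity
    have e3 : (Nat.factorial ((i : ℕ) - j) : ℝ) ≠ 0 := by positivity
    field_simp

theorem taylorShift_taylorShift (y z : ℝ) (u : Fin (k + 1) → ℝ) (s : Fin (k + 1)) :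
    taylorShift z (taylorShift y u) s = taylorShift (y + z) u s := by
  unfold taylorShift
  simp_rw [Finset.sum_mul]
  rw [Finset.sum_comm' (t' := Finset.Ici s) (s' := fun i => Finset.Icc s i)]
  · refine Finset.sum_congr rfl fun i hi => ?_
    rw [← sum_Icc_pow_div_factorial y z (Finset.mem_Ici.mp hi), Finset.mul_sum]
    refine Finset.sum_congr rfl fun j _ => ?_
    ring
  · intro j i
    simp only [Finset.mem_Ici, Finset.mem_Icc]
    constructor
    · rintro ⟨h1, h2⟩
      exact ⟨⟨h1, h2⟩, h1.trans h2⟩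
    · rintro ⟨⟨h1, h2⟩, -⟩
      exact ⟨h1, h2⟩

theorem mul_x (p q : JetSpace k) : (p * q).x = p.x + q.x := rfl

theorem mul_u (p q : JetSpace k) (s : Fin (k + 1)) :
    (p * q).u s = taylorShift q.x p.u s + q.u s := by
  have h : (p * q).u s = p.u s + q.u s
      + ∑ j ∈ Finset.Ioi s,
        p.u j * (q.x ^ ((j : ℕ) - s) / (Nat.factorial ((j : ℕ) - s) : ℝ)) := rfl
  rw [h, taylorShift, ← Finset.Ioi_insert s, Finset.sum_insert (by simp)]
  simp
  ring

noncomputable instance : Group (JetSpace k) :=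
  Group.ofLeftAxioms
    (by
      intro p q r
      ext s
      · simp only [mul_x]
        ring
      · rw [mul_u, mul_u, mul_u, mul_x, ← taylorShift_taylorShift]
        have h : (p * q).u = fun s => taylorShift q.x p.u s + q.u s := funext (mul_u p q)
        rw [h]
        simp only [taylorShift, add_mul, Finset.sum_add_distrib]
        ring)
    (by
      intro p
      ext s
      · rw [mul_x]
        exact zero_add _
      · rw [mul_u]
        have h : (1 : JetSpace k).u = fun _ => 0 := rfl
        simp [h, taylorShift])
    (by
      intro p
      ext s
      · rw [mul_x]
        exact neg_add_cancel _
      · rw [mul_u]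
        have h : (p⁻¹).u = fun s => -taylorShift (-p.x) p.u s := rfl
        have h1 : taylorShift p.x (fun s => -taylorShift (-p.x) p.u s) s
            = -taylorShift p.x (taylorShift (-p.x) p.u) s := by
          simp [taylorShift]
        rw [h, h1, taylorShift_taylorShift, neg_add_cancel, taylorShift_zero, neg_add_cancel]
        rfl)

/-! ### Horizontal curves and the Carnot-Carathéodory metric -/

/-- `γ` restricted to `[a, b]` is a horizontal curve: it is absolutely continuous as a map into
`ℝ^(k+2)`, and its derivative is annihilated almost everywhere by the contact forms
`du_j - u_{j+1} dx`, `j = 0, …, k-1`. -/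
structure IsHorizontalCurve (γ : ℝ → JetSpace k) (a b : ℝ) : Prop where
  ac_x : AbsolutelyContinuousOnInterval (fun τ => (γ τ).x) a b
  ac_u : ∀ j, AbsolutelyContinuousOnInterval (fun τ => (γ τ).u j) a b
  contact : ∀ᵐ τ ∂volume.restrict (Icc a b), ∀ j : Fin k,
    deriv (fun σ => (γ σ).u j.castSucc) τ = (γ τ).u j.succ * deriv (fun σ => (γ σ).x) τ

/-- The norm of the derivative of a horizontal curve, for the left-invariant frame
`X^(k) = ∂_x + u_k ∂_{u_{k-1}} + … + u_1 ∂_{u_0}`, `∂_{u_k}` being orthonormal. -/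
noncomputable def speed (γ : ℝ → JetSpace k) (τ : ℝ) : ℝ :=
  √(deriv (fun σ => (γ σ).x) τ ^ 2 + deriv (fun σ => (γ σ).u (Fin.last k)) τ ^ 2)

/-- The length of `γ` on `[a, b]`. -/
noncomputable def curveLength (γ : ℝ → JetSpace k) (a b : ℝ) : ℝ≥0∞ :=
  ∫⁻ τ in Icc a b, ENNReal.ofReal (speed γ τ)

/-- The Carnot-Carathéodory distance: the infimum of the lengths of the horizontal curves from `p`
to `q`. -/
noncomputable def ccDist (p q : JetSpace k) : ℝ≥0∞ :=
  ⨅ (γ : ℝ → JetSpace k) (a : ℝ) (b : ℝ)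
    (_ : a ≤ b ∧ IsHorizontalCurve γ a b ∧ γ a = p ∧ γ b = q), curveLength γ a b

theorem ccDist_le {γ : ℝ → JetSpace k} {a b : ℝ} (hab : a ≤ b) (h : IsHorizontalCurve γ a b) :
    ccDist (γ a) (γ b) ≤ curveLength γ a b :=
  iInf_le_of_le γ <| iInf_le_of_le a <| iInf_le_of_le b <| iInf_le _ ⟨hab, h, rfl, rfl⟩

theorem exists_curve_of_ccDist_lt {p q : JetSpace k} {c : ℝ≥0∞} (h : ccDist p q < c) :
    ∃ (γ : ℝ → JetSpace k) (a b : ℝ), a ≤ b ∧ IsHorizontalCurve γ a b ∧ γ a = p ∧ γ b = q ∧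
      curveLength γ a b < c := by
  simp only [ccDist, iInf_lt_iff] at h
  obtain ⟨γ, a, b, ⟨h1, h2, h3, h4⟩, h5⟩ := h
  exact ⟨γ, a, b, h1, h2, h3, h4, h5⟩

theorem ccDist_self (p : JetSpace k) : ccDist p p = 0 := by
  have h : IsHorizontalCurve (fun _ : ℝ => p) 0 0 :=
    { ac_x := contDiffOn_const.absolutelyContinuousOnInterval
      ac_u := fun j => contDiffOn_const.absolutelyContinuousOnInterval
      contact := by
        refine Filter.Eventually.of_forall fun τ j => ?_
        simp }
  have h1 := ccDist_le le_rfl h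
  have h2 : curveLength (fun _ : ℝ => p) 0 0 = 0 := by simp [curveLength]
  exact le_antisymm (h1.trans h2.le) bot_le

/-! Symmetry: reversal of curves. -/

theorem ac_comp_neg {f : ℝ → ℝ} {a b : ℝ} (h : AbsolutelyContinuousOnInterval f a b) :
    AbsolutelyContinuousOnInterval (fun τ => f (-τ)) (-b) (-a) := by
  rw [absolutelyContinuousOnInterval_iff] at h ⊢
  intro ε hε
  obtain ⟨δ, hδ, H⟩ := h ε hε
  refine ⟨δ, hδ, fun E hE hlt => ?_⟩
  have key := H (E.1, fun i => (-(E.2 i).1, -(E.2 i).2)) ?_ ?_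
  · exact key
  · obtain ⟨h1, h2⟩ := hE
    have hm : ∀ {y : ℝ}, y ∈ uIcc (-b) (-a) → -y ∈ uIcc a b := by
      intro y hy
      rw [mem_uIcc] at hy ⊢
      rcases hy with hy | hy
      · exact Or.inl ⟨by linarith [hy.2], by linarith [hy.1]⟩
      · exact Or.inr ⟨by linarith [hy.2], by linarith [hy.1]⟩
    refine ⟨fun i hi => ⟨hm (h1 i hi).1, hm (h1 i hi).2⟩, ?_⟩
    -- pairwise disjointness of half-open intervals is a statement on their end points
    have hd : ∀ a b c d : ℝ, Disjoint (uIoc a b) (uIoc c d) →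
        Disjoint (uIoc (-a) (-b)) (uIoc (-c) (-d)) := by
      intro a b c d hab
      simp only [uIoc, Ioc_disjoint_Ioc] at hab ⊢
      rw [min_neg_neg, min_neg_neg, max_neg_neg, max_neg_neg, min_neg_neg, max_neg_neg,
        neg_le_neg_iff]
      exact hab
    intro i hi j hj hij
    exact hd _ _ _ _ (h2 hi hj hij)
  · simpa [dist_neg_neg] using hlt

theorem ccDist_comm_le (p q : JetSpace k) : ccDist q p ≤ ccDist p q := by
  refine le_of_forall_gt fun c hc => ?_
  obtain ⟨γ, a, b, hab, hγ, rfl, rfl, hlt⟩ := exists_curve_of_ccDist_lt hc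
  have hdx : ∀ τ, deriv (fun σ => (γ (-σ)).x) τ = -deriv (fun σ => (γ σ).x) (-τ) :=
    fun τ => deriv_comp_neg (fun σ => (γ σ).x) τ
  have hdu : ∀ j τ, deriv (fun σ => (γ (-σ)).u j) τ = -deriv (fun σ => (γ σ).u j) (-τ) :=
    fun j τ => deriv_comp_neg (fun σ => (γ σ).u j) τ
  have hpre : (Neg.neg : ℝ → ℝ) ⁻¹' Icc a b = Icc (-b) (-a) := by
    ext τ
    simp only [mem_preimage, mem_Icc]
    constructor <;> rintro ⟨h1, h2⟩ <;> constructor <;> linarith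
  have hmp : MeasurePreserving (Neg.neg : ℝ → ℝ) (volume.restrict (Icc (-b) (-a)))
      (volume.restrict (Icc a b)) := by
    rw [← hpre]
    exact (Measure.measurePreserving_neg (volume : Measure ℝ)).restrict_preimage measurableSet_Icc
  have hh : IsHorizontalCurve (fun τ => γ (-τ)) (-b) (-a) :=
    { ac_x := ac_comp_neg (f := fun τ => (γ τ).x) hγ.ac_x
      ac_u := fun j => ac_comp_neg (f := fun τ => (γ τ).u j) (hγ.ac_u j)
      contact := by
        have hc := hmp.quasiMeasurePreserving.tendsto_ae.eventually hγ.contact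
        refine hc.mono fun τ hτ j => ?_
        have h1 := hτ j
        rw [hdx, hdu, h1]
        ring }
  have h1 := ccDist_le (by linarith) hh
  simp only [neg_neg] at h1
  refine lt_of_le_of_lt h1 (lt_of_eq_of_lt ?_ hlt)
  have hs : ∀ τ, speed (fun τ => γ (-τ)) τ = speed γ (-τ) := by
    intro τ
    simp only [speed, hdx, hdu, neg_sq]
  simp only [curveLength, hs]
  exact hmp.lintegral_comp_emb (MeasurableEquiv.neg ℝ).measurableEmbedding
    (fun τ => ENNReal.ofReal (speed γ τ))

/-! The triangle inequality: concatenation of curves. -/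

theorem ac_congr {f g : ℝ → ℝ} {a b : ℝ} (h : AbsolutelyContinuousOnInterval f a b)
    (hfg : ∀ τ ∈ uIcc a b, g τ = f τ) : AbsolutelyContinuousOnInterval g a b := by
  rw [absolutelyContinuousOnInterval_iff] at h ⊢
  intro ε hε
  obtain ⟨δ, hδ, H⟩ := h ε hε
  refine ⟨δ, hδ, fun E hE hlt => lt_of_eq_of_lt ?_ (H E hE hlt)⟩
  refine Finset.sum_congr rfl fun i hi => ?_
  rw [hfg _ (hE.1 i hi).1, hfg _ (hE.1 i hi).2]

theorem ac_trans {f : ℝ → ℝ} {a b c : ℝ} (hab : a ≤ b) (hbc : b ≤ c)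
    (h1 : AbsolutelyContinuousOnInterval f a b) (h2 : AbsolutelyContinuousOnInterval f b c) :
    AbsolutelyContinuousOnInterval f a c := by
  have i1 := h1.intervalIntegrable_deriv
  have i2 := h2.intervalIntegrable_deriv
  have h3 := (i1.trans i2).absolutelyContinuousOnInterval_intervalIntegral
    (c := a) left_mem_uIcc
  have h4 : AbsolutelyContinuousOnInterval (fun _ : ℝ => f a) a c :=
    contDiffOn_const.absolutelyContinuousOnInterval
  refine ac_congr (h4.add h3) fun τ hτ => ?_
  rw [uIcc_of_le (hab.trans hbc)] at hτ
  simp only [Pi.add_apply]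
  rcases le_total τ b with hτb | hτb
  · have hs : uIcc a τ ⊆ uIcc a b := by
      rw [uIcc_of_le hτ.1, uIcc_of_le hab]
      exact Icc_subset_Icc_right hτb
    rw [(h1.mono hs).integral_deriv_eq_sub]
    ring
  · have hs : uIcc b τ ⊆ uIcc b c := by
      rw [uIcc_of_le hτb, uIcc_of_le hbc]
      exact Icc_subset_Icc_right hτ.2
    have h5 := (h2.mono hs)
    rw [← intervalIntegral.integral_add_adjacent_intervals i1 h5.intervalIntegrable_deriv,
      h1.integral_deriv_eq_sub, h5.integral_deriv_eq_sub]
    ring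

theorem translate_ac {f : ℝ → ℝ} {a b : ℝ} (d : ℝ) (h : AbsolutelyContinuousOnInterval f a b) :
    AbsolutelyContinuousOnInterval (fun τ => f (τ - d)) (a + d) (b + d) := by
  rw [absolutelyContinuousOnInterval_iff] at h ⊢
  intro ε hε
  obtain ⟨δ, hδ, H⟩ := h ε hε
  refine ⟨δ, hδ, fun E hE hlt => ?_⟩
  have key := H (E.1, fun i => ((E.2 i).1 - d, (E.2 i).2 - d)) ?_ ?_
  · exact key
  · obtain ⟨h1, h2⟩ := hE
    have hm : ∀ {y : ℝ}, y ∈ uIcc (a + d) (b + d) → y - d ∈ uIcc a b := by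
      intro y hy
      rw [mem_uIcc] at hy ⊢
      rcases hy with hy | hy
      · exact Or.inl ⟨by linarith [hy.1], by linarith [hy.2]⟩
      · exact Or.inr ⟨by linarith [hy.1], by linarith [hy.2]⟩
    refine ⟨fun i hi => ⟨hm (h1 i hi).1, hm (h1 i hi).2⟩, ?_⟩
    intro i hi j hj hij
    have hd := h2 hi hj hij
    simp only [Function.onFun, uIoc, Ioc_disjoint_Ioc] at hd ⊢
    simp only [min_sub_sub_right, max_sub_sub_right]
    linarith
  · simpa [dist_sub_right] using hlt

theorem isHorizontalCurve_translate {γ : ℝ → JetSpace k} {a b : ℝ} (d : ℝ)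
    (h : IsHorizontalCurve γ a b) :
    IsHorizontalCurve (fun τ => γ (τ - d)) (a + d) (b + d) ∧
      curveLength (fun τ => γ (τ - d)) (a + d) (b + d) = curveLength γ a b := by
  have hdx : ∀ τ, deriv (fun σ => (γ (σ - d)).x) τ = deriv (fun σ => (γ σ).x) (τ - d) :=
    fun τ => deriv_comp_sub_const (f := fun σ => (γ σ).x) d τ
  have hdu : ∀ j τ, deriv (fun σ => (γ (σ - d)).u j) τ = deriv (fun σ => (γ σ).u j) (τ - d) :=
    fun j τ => deriv_comp_sub_const (f := fun σ => (γ σ).u j) d τ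
  have hpre : (fun τ : ℝ => τ - d) ⁻¹' Icc a b = Icc (a + d) (b + d) := by
    simp
  have hmp : MeasurePreserving (fun τ : ℝ => τ - d) (volume.restrict (Icc (a + d) (b + d)))
      (volume.restrict (Icc a b)) := by
    rw [← hpre]
    exact (measurePreserving_sub_right (volume : Measure ℝ) d).restrict_preimage measurableSet_Icc
  refine ⟨⟨translate_ac (f := fun τ => (γ τ).x) d h.ac_x,
    fun j => translate_ac (f := fun τ => (γ τ).u j) d (h.ac_u j), ?_⟩, ?_⟩
  · have hc := hmp.quasiMeasurePreserving.tendsto_ae.eventually h.contact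
    refine hc.mono fun τ hτ j => ?_
    have h1 := hτ j
    rw [hdx, hdu, h1]
  · have hs : ∀ τ, speed (fun τ => γ (τ - d)) τ = speed γ (τ - d) := by
      intro τ
      simp only [speed, hdx, hdu]
    simp only [curveLength, hs]
    exact hmp.lintegral_comp_emb (measurableEmbedding_subRight d)
      (fun τ => ENNReal.ofReal (speed γ τ))

theorem ae_Icc_iff {P : ℝ → Prop} {a b : ℝ} :
    (∀ᵐ τ ∂volume.restrict (Icc a b), P τ) ↔ ∀ᵐ τ ∂volume.restrict (Ioo a b), P τ := by
  rw [Measure.restrict_congr_set (Ioo_ae_eq_Icc (μ := (volume : Measure ℝ))).symm]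

theorem ccDist_triangle_aux {γ₁ γ₂ : ℝ → JetSpace k} {a b c : ℝ} (hab : a ≤ b) (hbc : b ≤ c)
    (h₁ : IsHorizontalCurve γ₁ a b) (h₂ : IsHorizontalCurve γ₂ b c) (hb : γ₁ b = γ₂ b) :
    ccDist (γ₁ a) (γ₂ c) ≤ curveLength γ₁ a b + curveLength γ₂ b c := by
  classical
  set γ : ℝ → JetSpace k := fun τ => if τ ≤ b then γ₁ τ else γ₂ τ with hγ
  have e1 : ∀ τ, τ ≤ b → γ τ = γ₁ τ := fun τ hτ => if_pos hτ
  have e2 : ∀ τ, b ≤ τ → γ τ = γ₂ τ := by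
    intro τ hτ
    rcases hτ.eq_or_lt with rfl | hτ
    · rw [e1 _ le_rfl, hb]
    · exact if_neg (not_le.mpr hτ)
  have d1 : ∀ (F : JetSpace k → ℝ) τ, τ < b →
      deriv (fun σ => F (γ σ)) τ = deriv (fun σ => F (γ₁ σ)) τ := by
    intro F τ hτ
    apply Filter.EventuallyEq.deriv_eq
    filter_upwards [Iio_mem_nhds hτ] with σ hσ
    rw [e1 σ (le_of_lt hσ)]
  have d2 : ∀ (F : JetSpace k → ℝ) τ, b < τ →
      deriv (fun σ => F (γ σ)) τ = deriv (fun σ => F (γ₂ σ)) τ := by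
    intro F τ hτ
    apply Filter.EventuallyEq.deriv_eq
    filter_upwards [Ioi_mem_nhds hτ] with σ hσ
    rw [e2 σ (le_of_lt hσ)]
  have glue : ∀ F : JetSpace k → ℝ, AbsolutelyContinuousOnInterval (fun τ => F (γ₁ τ)) a b →
      AbsolutelyContinuousOnInterval (fun τ => F (γ₂ τ)) b c →
      AbsolutelyContinuousOnInterval (fun τ => F (γ τ)) a c := by
    intro F k1 k2
    refine ac_trans hab hbc (ac_congr k1 ?_) (ac_congr k2 ?_)
    · intro τ hτ
      rw [uIcc_of_le hab] at hτ
      rw [e1 τ hτ.2]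
    · intro τ hτ
      rw [uIcc_of_le hbc] at hτ
      rw [e2 τ hτ.1]
  have hh : IsHorizontalCurve γ a c := by
    refine ⟨glue (fun p => p.x) h₁.ac_x h₂.ac_x,
      fun j => glue (fun p => p.u j) (h₁.ac_u j) (h₂.ac_u j), ?_⟩
    rw [← Icc_union_Icc_eq_Icc hab hbc, ae_restrict_union_iff, ae_Icc_iff, ae_Icc_iff]
    constructor
    · filter_upwards [ae_Icc_iff.mp h₁.contact, ae_restrict_mem measurableSet_Ioo] with τ hτ hm j
      rw [d1 (fun p => p.x) τ hm.2, d1 (fun p => p.u j.castSucc) τ hm.2, e1 τ hm.2.le, hτ j]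
    · filter_upwards [ae_Icc_iff.mp h₂.contact, ae_restrict_mem measurableSet_Ioo] with τ hτ hm j
      rw [d2 (fun p => p.x) τ hm.1, d2 (fun p => p.u j.castSucc) τ hm.1, e2 τ hm.1.le, hτ j]
  have hle := ccDist_le (hab.trans hbc) hh
  rw [e1 a hab, e2 c hbc] at hle
  refine hle.trans ?_
  unfold curveLength
  rw [← Icc_union_Icc_eq_Icc hab hbc]
  refine (lintegral_union_le _ _ _).trans (add_le_add (le_of_eq ?_) (le_of_eq ?_))
  · refine lintegral_congr_ae (ae_Icc_iff.mpr ?_)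
    filter_upwards [ae_restrict_mem measurableSet_Ioo] with τ hm
    simp only [speed]
    rw [d1 (fun p => p.x) τ hm.2, d1 (fun p => p.u (Fin.last k)) τ hm.2]
  · refine lintegral_congr_ae (ae_Icc_iff.mpr ?_)
    filter_upwards [ae_restrict_mem measurableSet_Ioo] with τ hm
    simp only [speed]
    rw [d2 (fun p => p.x) τ hm.1, d2 (fun p => p.u (Fin.last k)) τ hm.1]

theorem ccDist_triangle (p q r : JetSpace k) : ccDist p r ≤ ccDist p q + ccDist q r := by
  refine ENNReal.le_of_forall_pos_le_add fun ε hε hlt => ?_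
  have hε' : (ε / 2 : ℝ≥0∞) ≠ 0 := by simpa using hε.ne'
  have hpq : ccDist p q < ⊤ := lt_of_le_of_lt le_self_add hlt
  have hqr : ccDist q r < ⊤ := lt_of_le_of_lt le_add_self hlt
  obtain ⟨γ₁, a, b, hab, h₁, rfl, rfl, l₁⟩ :=
    exists_curve_of_ccDist_lt (ENNReal.lt_add_right hpq.ne hε')
  obtain ⟨γ₂, b', c, hbc, h₂, hb', rfl, l₂⟩ :=
    exists_curve_of_ccDist_lt (ENNReal.lt_add_right hqr.ne hε')
  obtain ⟨h₃, l₃⟩ := isHorizontalCurve_translate (b - b') h₂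
  have hbb : b' + (b - b') = b := by ring
  rw [hbb] at h₃ l₃
  have key := ccDist_triangle_aux hab (by linarith) h₁ h₃ (by simp [hb'])
  have hc : c + (b - b') - (b - b') = c := by ring
  simp only [hc] at key
  refine key.trans ?_
  rw [l₃]
  refine (add_le_add l₁.le l₂.le).trans (le_of_eq ?_)
  rw [add_add_add_comm, ENNReal.add_halves]

/-! Separation of points. -/

theorem abs_sub_le_of_deriv_le {f g : ℝ → ℝ} {a b C L : ℝ} (hC : 0 ≤ C) (hL : 0 ≤ L)
    (hf : AbsolutelyContinuousOnInterval f a b)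
    (hd : ∀ᵐ τ ∂volume.restrict (Icc a b), |deriv f τ| ≤ C * g τ)
    (hg : ∫⁻ τ in Icc a b, ENNReal.ofReal (g τ) ≤ ENNReal.ofReal L) {τ : ℝ} (hτ : τ ∈ Icc a b) :
    |f τ - f a| ≤ C * L := by
  have hab : a ≤ b := hτ.1.trans hτ.2
  have hs : uIcc a τ ⊆ uIcc a b := by
    rw [uIcc_of_le hτ.1, uIcc_of_le hab]
    exact Icc_subset_Icc_right hτ.2
  have h1 : ‖f τ - f a‖ₑ ≤ ENNReal.ofReal (C * L) := by
    rw [← (hf.mono hs).integral_deriv_eq_sub, intervalIntegral.integral_of_le hτ.1]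
    calc ‖∫ σ in Ioc a τ, deriv f σ‖ₑ
        ≤ ∫⁻ σ in Ioc a τ, ‖deriv f σ‖ₑ := enorm_integral_le_lintegral_enorm _
      _ ≤ ∫⁻ σ in Icc a b, ‖deriv f σ‖ₑ :=
          lintegral_mono_set (Ioc_subset_Icc_self.trans (Icc_subset_Icc_right hτ.2))
      _ ≤ ∫⁻ σ in Icc a b, ENNReal.ofReal C * ENNReal.ofReal (g σ) := by
          refine lintegral_mono_ae ?_
          filter_upwards [hd] with σ hσ
          rw [← ENNReal.ofReal_mul hC, Real.enorm_eq_ofReal_abs]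
          exact ENNReal.ofReal_le_ofReal hσ
      _ = ENNReal.ofReal C * ∫⁻ σ in Icc a b, ENNReal.ofReal (g σ) :=
          lintegral_const_mul' _ _ ENNReal.ofReal_ne_top
      _ ≤ ENNReal.ofReal C * ENNReal.ofReal L := by gcongr
      _ = ENNReal.ofReal (C * L) := (ENNReal.ofReal_mul hC).symm
  rw [Real.enorm_eq_ofReal_abs] at h1
  exact (ENNReal.ofReal_le_ofReal_iff (mul_nonneg hC hL)).mp h1

theorem abs_deriv_x_le_speed (γ : ℝ → JetSpace k) (τ : ℝ) :
    |deriv (fun σ => (γ σ).x) τ| ≤ speed γ τ :=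
  Real.abs_le_sqrt (le_add_of_nonneg_right (sq_nonneg _))

theorem abs_deriv_u_le_speed (γ : ℝ → JetSpace k) (τ : ℝ) :
    |deriv (fun σ => (γ σ).u (Fin.last k)) τ| ≤ speed γ τ :=
  Real.abs_le_sqrt (le_add_of_nonneg_left (sq_nonneg _))

theorem exists_bound_u (p : JetSpace k) (j : Fin (k + 1)) :
    ∃ C : ℝ, 0 ≤ C ∧ ∀ (γ : ℝ → JetSpace k) (a b L : ℝ), IsHorizontalCurve γ a b → γ a = p →
      0 ≤ L → L ≤ 1 → curveLength γ a b ≤ ENNReal.ofReal L →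
      ∀ τ ∈ Icc a b, |(γ τ).u j - p.u j| ≤ C * L := by
  induction j using Fin.reverseInduction with
  | last =>
    refine ⟨1, zero_le_one, ?_⟩
    rintro γ a b L hγ rfl hL - hlen τ hτ
    refine abs_sub_le_of_deriv_le (f := fun σ => (γ σ).u (Fin.last k)) zero_le_one hL (hγ.ac_u _)
      (Filter.Eventually.of_forall fun σ => ?_) hlen hτ
    rw [one_mul]
    exact abs_deriv_u_le_speed γ σ
  | cast j ih =>
    obtain ⟨C, hC, H⟩ := ih
    have hC' : 0 ≤ |p.u j.succ| + C := add_nonneg (abs_nonneg _) hC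
    refine ⟨|p.u j.succ| + C, hC', ?_⟩
    rintro γ a b L hγ rfl hL hL1 hlen τ hτ
    refine abs_sub_le_of_deriv_le (f := fun σ => (γ σ).u j.castSucc) hC' hL (hγ.ac_u _)
      ?_ hlen hτ
    filter_upwards [hγ.contact, ae_restrict_mem measurableSet_Icc] with σ hσ hm
    rw [hσ j, abs_mul]
    have h1 := H γ a b L hγ rfl hL hL1 hlen σ hm
    have h2 : |(γ σ).u j.succ| ≤ |(γ a).u j.succ| + C := by
      have h3 := abs_sub_abs_le_abs_sub ((γ σ).u j.succ) ((γ a).u j.succ)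
      have h4 : C * L ≤ C := mul_le_of_le_one_right hC hL1
      linarith
    exact mul_le_mul h2 (abs_deriv_x_le_speed γ σ) (abs_nonneg _) hC'

theorem eq_of_forall_abs_sub_le {r s C : ℝ}
    (h : ∀ L : ℝ, 0 < L → L ≤ 1 → |s - r| ≤ C * L) : r = s := by
  by_contra hne
  have hpos : 0 < |s - r| := abs_pos.mpr (sub_ne_zero.mpr (Ne.symm hne))
  have hC : 0 < C := by
    have := h 1 one_pos le_rfl
    linarith
  have hm : 0 < min 1 (|s - r| / (2 * C)) := lt_min one_pos (by positivity)
  have h1 := h _ hm (min_le_left _ _)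
  have h2 : C * min 1 (|s - r| / (2 * C)) ≤ C * (|s - r| / (2 * C)) :=
    mul_le_mul_of_nonneg_left (min_le_right _ _) hC.le
  have h3 : C * (|s - r| / (2 * C)) = |s - r| / 2 := by field_simp
  linarith

theorem eq_of_ccDist_eq_zero {p q : JetSpace k} (h : ccDist p q = 0) : p = q := by
  have hex : ∀ L : ℝ, 0 < L → ∃ (γ : ℝ → JetSpace k) (a b : ℝ), a ≤ b ∧ IsHorizontalCurve γ a b ∧
      γ a = p ∧ γ b = q ∧ curveLength γ a b < ENNReal.ofReal L := by
    intro L hL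
    apply exists_curve_of_ccDist_lt
    rw [h]
    exact ENNReal.ofReal_pos.mpr hL
  ext j
  · refine eq_of_forall_abs_sub_le (C := 1) fun L hL _ => ?_
    obtain ⟨γ, a, b, hab, hγ, rfl, rfl, hlen⟩ := hex L hL
    refine abs_sub_le_of_deriv_le (f := fun σ => (γ σ).x) zero_le_one hL.le hγ.ac_x
      (Filter.Eventually.of_forall fun σ => ?_) hlen.le (right_mem_Icc.mpr hab)
    rw [one_mul]
    exact abs_deriv_x_le_speed γ σ
  · obtain ⟨C, -, H⟩ := exists_bound_u p j
    refine eq_of_forall_abs_sub_le (C := C) fun L hL hL1 => ?_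
    obtain ⟨γ, a, b, hab, hγ, ha, rfl, hlen⟩ := hex L hL
    exact H γ a b L hγ ha hL.le hL1 hlen.le b (right_mem_Icc.mpr hab)

/-- `J^k(ℝ)` is equipped with the Carnot-Carathéodory metric. -/
noncomputable instance : EMetricSpace (JetSpace k) where
  edist := ccDist
  edist_self := ccDist_self
  edist_comm p q := le_antisymm (ccDist_comm_le q p) (ccDist_comm_le p q)
  edist_triangle := ccDist_triangle
  eq_of_edist_eq_zero := eq_of_ccDist_eq_zero

/-! ### Jets, and the horizontal and vertical mappings -/

/-- The jet `j^k_x(f) = (x, f^(k)(x), …, f'(x), f(x))`. -/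
noncomputable def jet (k : ℕ) (f : ℝ → ℝ) (x : ℝ) : JetSpace k where
  x := x
  u := fun j => iteratedDeriv j f x

/-- The vertical hyperplane `{x = t}`. -/
def verticalPlane (k : ℕ) (t : ℝ) : Set (JetSpace k) := {p | p.x = t}

/-- The horizontal mapping `J_{f,t}(p) = j^k_{x-t}(f)`, for `p = (x, u_k, …, u_0)`. -/
noncomputable def horizontalMap (f : ℝ → ℝ) (t : ℝ) (p : JetSpace k) : JetSpace k :=
  jet k f (p.x - t)

/-- The vertical mapping `V_{f,t}(p) = p ⊙ j^k_{x-t}(f)⁻¹`, for `p = (x, u_k, …, u_0)`. -/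
noncomputable def verticalMap (f : ℝ → ℝ) (t : ℝ) (p : JetSpace k) : JetSpace k :=
  p * (jet k f (p.x - t))⁻¹

end JetSpace

namespace JetSpace

variable {k : ℕ}

/-! ### Left translations -/

/-! On `{x = t}` the jet is always taken at `0`. So the horizontal map is constant there, and the
vertical map is right multiplication by one fixed element `(0, c)`. Since `(t, u) ⊙ (0, c) = (t, u +
c)`, addition being commutative, this agrees on the plane with a left translation, which is an
isometry. Everything reduces to finding a compact subset of the plane of dimension `β`,
independently of `f`.

On the plane, the distance from `u` to `v` is comparable to the maximum of `|u_j - v_j|^(1/w_j)`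
with `w_j = k + 1 - j`. The lower bound comes from integrating the contact equations (`abs_u_le`),
the upper bound from dilations and the finiteness of the distance to each coordinate vector
(`exists_edist_vertical_le`). The plane therefore looks like a product of snowflaked lines of total
dimension `Q = ∑ w_j = (k+1)(k+2)/2`.

Let the coordinate `u_j` run over a Cantor set with `2^(w_j)` digits in the base `l^(w_j)`. The
product is metrically self-similar, with `2^Q` pieces of ratio `l`, so its dimension is `β` when
`2^Q l^β = 1`. The condition `l ≤ 1/2` amounts to `β ≤ Q`. For `l < 1/2` the pieces are separated,
and counting cylinders (`dimH_range_le_of_digits`) and a Hölder map onto `[0, 1]`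
(`le_dimH_range_of_digits`) give the two bounds. For `l = 1/2` separation fails, but the set is a
full box containing all the thinner Cantor sets, and monotonicity gives dimension at least `Q`. For
`β = 0` a point suffices. -/

theorem ac_pow {f : ℝ → ℝ} {a b : ℝ} (h : AbsolutelyContinuousOnInterval f a b) (n : ℕ) :
    AbsolutelyContinuousOnInterval (fun τ => f τ ^ n) a b := by
  induction n with
  | zero =>
    simp only [pow_zero]
    exact contDiffOn_const.absolutelyContinuousOnInterval
  | succ n ih =>
    simp only [pow_succ]
    exact ih.mul h

theorem ac_sum {ι : Type*} (s : Finset ι) {f : ι → ℝ → ℝ} {a b : ℝ}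
    (h : ∀ i ∈ s, AbsolutelyContinuousOnInterval (f i) a b) :
    AbsolutelyContinuousOnInterval (fun τ => ∑ i ∈ s, f i τ) a b := by
  classical
  induction s using Finset.induction_on with
  | empty =>
    simp only [Finset.sum_empty]
    exact contDiffOn_const.absolutelyContinuousOnInterval
  | insert i s hi ih =>
    simp only [Finset.sum_insert hi]
    exact (h i (Finset.mem_insert_self i s)).add
      (ih fun j hj => h j (Finset.mem_insert_of_mem hj))

theorem ac_taylorShift {f : ℝ → ℝ} {a b : ℝ} (h : AbsolutelyContinuousOnInterval f a b)
    (u : Fin (k + 1) → ℝ) (s : Fin (k + 1)) :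
    AbsolutelyContinuousOnInterval (fun τ => taylorShift (f τ) u s) a b := by
  unfold taylorShift
  refine ac_sum _ fun j _ => ?_
  simp only [div_eq_inv_mul]
  exact ((ac_pow h _).const_mul _).const_mul _

theorem taylorShift_last (y : ℝ) (u : Fin (k + 1) → ℝ) :
    taylorShift y u (Fin.last k) = u (Fin.last k) := by
  have h : Finset.Ici (Fin.last k) = {Fin.last k} := by
    ext j
    simp [Fin.last_le_iff]
  simp [taylorShift, h]

/-- Each term `z^(d+1)/(d+1)!` differentiates to `z^d/d!`, so the Taylor shifts of a fixed vector
satisfy the contact relations in `z`. This is what makes the contact equations left-invariant. -/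
theorem hasDerivAt_taylorShift (u : Fin (k + 1) → ℝ) (s : Fin k) (y : ℝ) :
    HasDerivAt (fun z => taylorShift z u s.castSucc) (taylorShift y u s.succ) y := by
  have hset : Finset.Ici s.castSucc = insert s.castSucc (Finset.Ici s.succ) := by
    ext j
    simp only [Finset.mem_Ici, Finset.mem_insert, Fin.le_def, Fin.ext_iff, Fin.val_castSucc,
      Fin.val_succ]
    omega
  have hnot : s.castSucc ∉ Finset.Ici s.succ := by
    simp [Fin.le_def]
  have h0 : (fun z => taylorShift z u s.castSucc) = fun z => u s.castSucc
      + ∑ j ∈ Finset.Ici s.succ,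
        u j * (z ^ ((j : ℕ) - s) / (Nat.factorial ((j : ℕ) - s) : ℝ)) := by
    funext z
    rw [taylorShift, hset, Finset.sum_insert hnot]
    simp
  rw [h0, taylorShift]
  refine (HasDerivAt.fun_sum fun j hj => ?_).const_add _
  refine HasDerivAt.const_mul _ ?_
  have hj' : (s : ℕ) + 1 ≤ j := by simpa [Fin.le_def] using hj
  obtain ⟨d, hd⟩ := Nat.exists_eq_add_of_le hj'
  have e1 : (j : ℕ) - s = d + 1 := by omega
  have e2 : (j : ℕ) - s.succ = d := by simp; omega
  rw [e1, e2]
  have h := (hasDerivAt_pow (d + 1) y).div_const ((d + 1).factorial : ℝ)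
  convert h using 1
  rw [Nat.factorial_succ]
  push_cast
  have : ((d : ℝ) + 1) ≠ 0 := by positivity
  field_simp

theorem ae_differentiableAt_of_ac {f : ℝ → ℝ} {a b : ℝ} (hab : a ≤ b)
    (h : AbsolutelyContinuousOnInterval f a b) :
    ∀ᵐ τ ∂volume.restrict (Icc a b), DifferentiableAt ℝ f τ := by
  rw [ae_restrict_iff' measurableSet_Icc]
  filter_upwards [h.ae_differentiableAt] with τ hτ hm
  exact hτ (by rwa [uIcc_of_le hab])

theorem isHorizontalCurve_mul_left (g : JetSpace k) {γ : ℝ → JetSpace k} {a b : ℝ} (hab : a ≤ b)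
    (h : IsHorizontalCurve γ a b) : IsHorizontalCurve (fun τ => g * γ τ) a b := by
  refine ⟨?_, fun j => ?_, ?_⟩
  · simp only [mul_x]
    exact AbsolutelyContinuousOnInterval.add
      contDiffOn_const.absolutelyContinuousOnInterval h.ac_x
  · simp only [mul_u]
    exact (ac_taylorShift h.ac_x _ _).add (h.ac_u j)
  · filter_upwards [h.contact, ae_differentiableAt_of_ac hab h.ac_x,
      ae_all_iff.mpr fun j => ae_differentiableAt_of_ac hab (h.ac_u j)] with τ h1 h2 h3 j
    simp only [mul_u, mul_x]
    have h4 := (hasDerivAt_taylorShift g.u j (γ τ).x).comp τ h2.hasDerivAt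
    have h5 := h4.add (h3 j.castSucc).hasDerivAt
    rw [deriv_const_add]
    refine h5.deriv.trans ?_
    rw [h1 j]
    ring

/-- A left translation changes `x` and `u_k`, the only coordinates seen by the speed, by additive
constants. -/
theorem speed_mul_left (g : JetSpace k) (γ : ℝ → JetSpace k) (τ : ℝ) :
    speed (fun τ => g * γ τ) τ = speed γ τ := by
  simp only [speed, mul_x, mul_u, taylorShift_last, deriv_const_add]

theorem edist_mul_left_le (g p q : JetSpace k) : edist (g * p) (g * q) ≤ edist p q := by
  refine le_of_forall_gt fun c hc => ?_
  obtain ⟨γ, a, b, hab, hγ, rfl, rfl, hlt⟩ := exists_curve_of_ccDist_lt hc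
  refine (ccDist_le hab (isHorizontalCurve_mul_left g hab hγ)).trans_lt ?_
  simpa only [curveLength, speed_mul_left] using hlt

/-- Left translations are isometries of the Carnot-Carathéodory metric. -/
theorem isometry_mul_left (g : JetSpace k) : Isometry (fun p : JetSpace k => g * p) := by
  intro p q
  refine le_antisymm (edist_mul_left_le g p q) ?_
  -- Translations do not increase distances; applying this to `g⁻¹` gives the reverse inequality.
  simpa using edist_mul_left_le g⁻¹ (g * p) (g * q)

/-! ### Dilations -/

/-- The weight of the coordinate `u_j`. -/
def weight (j : Fin (k + 1)) : ℕ := k + 1 - j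

theorem weight_pos (j : Fin (k + 1)) : 0 < weight j := by
  have := j.isLt
  unfold weight
  omega

theorem weight_last : weight (Fin.last k) = 1 := by simp [weight]

theorem weight_castSucc (j : Fin k) : weight j.castSucc = weight j.succ + 1 := by
  have := j.isLt
  simp only [weight, Fin.val_castSucc, Fin.val_succ]
  omega

theorem sum_weight : ∑ j : Fin (k + 1), (weight j : ℝ) = ((k : ℝ) + 1) * ((k : ℝ) + 2) / 2 := by
  have h : ∀ j : Fin (k + 1), (weight j : ℝ) = (k : ℝ) + 1 - (j : ℕ) := by
    intro j
    rw [weight, Nat.cast_sub j.isLt.le]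
    push_cast
    rfl
  simp only [h]
  rw [Fin.sum_univ_eq_sum_range (fun j => (k : ℝ) + 1 - (j : ℝ))]
  have : ∀ n : ℕ, ∑ j ∈ Finset.range n, ((k : ℝ) + 1 - (j : ℝ))
      = n * (k + 1) - n * (n - 1) / 2 := by
    intro n
    induction n with
    | zero => simp
    | succ n ih =>
      rw [Finset.sum_range_succ, ih]
      push_cast
      ring
  rw [this]
  push_cast
  ring

/-- The dilation `(x, u_k, …, u_0) ↦ (r x, r u_k, …, r^(k+1) u_0)`. -/
def dilation (r : ℝ) (p : JetSpace k) : JetSpace k where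
  x := r * p.x
  u := fun j => r ^ weight j * p.u j

/-- Dilation maps horizontal curves to horizontal curves, because the weight of `u_j` is that of
`u_{j+1}` plus the weight `1` of `x`. It multiplies the speed by `r`, since `x` and `u_k` both have
weight `1`. -/
theorem edist_dilation_le {r : ℝ} (hr : 0 ≤ r) (p q : JetSpace k) :
    edist (dilation r p) (dilation r q) ≤ ENNReal.ofReal r * edist p q := by
  rcases hr.eq_or_lt with rfl | hr
  · have h : ∀ p : JetSpace k, dilation 0 p = 1 := fun p => by
      ext j
      · exact zero_mul _
      · exact (congrArg (· * p.u j) (zero_pow (weight_pos j).ne')).trans (zero_mul _)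
    simp [h]
  refine ENNReal.le_of_forall_pos_le_add fun ε hε _ => ?_
  by_cases htop : edist p q = ⊤
  · simp [htop, ENNReal.mul_top, hr]
  have hr0 : ENNReal.ofReal r ≠ 0 := by simpa using hr
  obtain ⟨γ, a, b, hab, hγ, rfl, rfl, hlt⟩ := exists_curve_of_ccDist_lt
    (ENNReal.lt_add_right htop (ENNReal.div_pos (ENNReal.coe_ne_zero.mpr hε.ne')
      ENNReal.ofReal_ne_top).ne' : edist p q < edist p q + ε / ENNReal.ofReal r)
  have hh : IsHorizontalCurve (fun τ => dilation r (γ τ)) a b := by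
    refine ⟨hγ.ac_x.const_mul r, fun j => (hγ.ac_u j).const_mul _, ?_⟩
    filter_upwards [hγ.contact] with τ hτ j
    simp only [dilation, deriv_const_mul_field]
    rw [hτ j, weight_castSucc]
    ring
  have hs : ∀ τ, ENNReal.ofReal (speed (fun τ => dilation r (γ τ)) τ)
      = ENNReal.ofReal r * ENNReal.ofReal (speed γ τ) := by
    intro τ
    rw [← ENNReal.ofReal_mul hr.le]
    simp only [speed, dilation, deriv_const_mul_field, weight_last, pow_one, mul_pow]
    rw [← mul_add, Real.sqrt_mul (sq_nonneg r), Real.sqrt_sq hr.le]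
  refine (ccDist_le hab hh).trans ?_
  simp only [curveLength, hs]
  rw [lintegral_const_mul' _ _ ENNReal.ofReal_ne_top]
  refine (mul_le_mul_right hlt.le _).trans (le_of_eq ?_)
  rw [mul_add, ENNReal.mul_div_cancel hr0 ENNReal.ofReal_ne_top]

/-! ### Finiteness of the distance along jets -/

theorem contDiff_iteratedDeriv {f : ℝ → ℝ} (hf : ContDiff ℝ ∞ f) (n : ℕ) :
    ContDiff ℝ ∞ (iteratedDeriv n f) := by
  rw [iteratedDeriv_eq_iterate]
  exact ContDiff.iterate_deriv n hf

/-- The jet curve of a smooth function is horizontal, with the continuous speed `√(1 + (f^(k+1))²)`.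
-/
theorem edist_jet_lt_top {f : ℝ → ℝ} (hf : ContDiff ℝ ∞ f) {a b : ℝ} (hab : a ≤ b) :
    edist (jet k f a) (jet k f b) < ⊤ := by
  have hh : IsHorizontalCurve (jet k f) a b := by
    refine ⟨?_, fun j => ?_, ?_⟩
    · exact contDiffOn_id.absolutelyContinuousOnInterval
    · exact ((contDiff_iteratedDeriv hf j).of_le
        (by norm_cast)).contDiffOn.absolutelyContinuousOnInterval
    · refine Filter.Eventually.of_forall fun τ j => ?_
      simp [jet, iteratedDeriv_succ]
  refine (ccDist_le hab hh).trans_lt ?_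
  have hc : Continuous (speed (jet k f)) := by
    have h1 : deriv (fun σ => (jet k f σ).u (Fin.last k)) = iteratedDeriv (k + 1) f := by
      rw [iteratedDeriv_succ]
      rfl
    have h2 : deriv (fun σ => (jet k f σ).x) = fun _ => 1 := by
      funext τ
      simp [jet]
    unfold speed
    rw [h1, h2]
    have := (contDiff_iteratedDeriv hf (k + 1)).continuous
    fun_prop
  exact (hc.continuousOn.integrableOn_Icc).lintegral_lt_top

/-- The point `(t, u_k, …, u_0)` of the plane `{x = t}`. -/
def vertical (t : ℝ) (u : Fin (k + 1) → ℝ) : JetSpace k := ⟨t, u⟩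

theorem jet_zero (x : ℝ) : jet k (fun _ => 0) x = vertical x 0 := by
  ext j
  · rfl
  · simp [jet, vertical]

/-- A monomial times a cutoff which is `1` for `x ≤ 1/3` and `0` for `x ≥ 2/3`: its jet curve joins
a coordinate vector over `0` to the zero jet over `1`. -/
theorem exists_contDiff_jet (j : Fin (k + 1)) (s : ℝ) :
    ∃ f : ℝ → ℝ, ContDiff ℝ ∞ f ∧ jet k f 0 = vertical 0 (Pi.single j s) ∧
      jet k f 1 = vertical 1 0 := by
  refine ⟨fun x => (s / (j : ℕ).factorial) * x ^ (j : ℕ) * Real.smoothTransition (2 - 3 * x),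
    ?_, ?_, ?_⟩
  · have := Real.smoothTransition.contDiff (n := ⊤)
    fun_prop
  · ext i
    · rfl
    · have he : (fun x : ℝ => (s / (j : ℕ).factorial) * x ^ (j : ℕ)
          * Real.smoothTransition (2 - 3 * x)) =ᶠ[nhds 0]
          fun x => (s / (j : ℕ).factorial) * x ^ (j : ℕ) := by
        filter_upwards [Iio_mem_nhds (show (0 : ℝ) < 1 / 3 by norm_num)] with x hx
        rw [Real.smoothTransition.one_of_one_le, mul_one]
        have : x < 1 / 3 := hx
        linarith
      simp only [jet, vertical]
      rw [he.iteratedDeriv_eq, iteratedDeriv_const_mul_field, iteratedDeriv_fun_pow_zero]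
      rcases eq_or_ne i j with rfl | hij
      · have : ((i : ℕ).factorial : ℝ) ≠ 0 := by positivity
        simp
        field_simp
      · have : (i : ℕ) ≠ j := fun h => hij (Fin.ext h)
        simp [this, hij]
  · have he : (fun x : ℝ => (s / (j : ℕ).factorial) * x ^ (j : ℕ)
          * Real.smoothTransition (2 - 3 * x)) =ᶠ[nhds 1] fun _ => 0 := by
      filter_upwards [Ioi_mem_nhds (show (2 / 3 : ℝ) < 1 by norm_num)] with x hx
      rw [Real.smoothTransition.zero_of_nonpos, mul_zero]
      have : 2 / 3 < x := hx
      linarith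
    rw [← jet_zero]
    ext i
    · rfl
    · exact he.iteratedDeriv_eq i

theorem vertical_zero_zero : vertical 0 0 = (1 : JetSpace k) := rfl

/-- Go out from `x = 0` to `x = 1` along the jet of the zero function, and come back along the jet
of the cut-off monomial. -/
theorem edist_one_single_lt_top (j : Fin (k + 1)) (s : ℝ) :
    edist (1 : JetSpace k) (vertical 0 (Pi.single j s)) < ⊤ := by
  obtain ⟨f, hf, h0, h1⟩ := exists_contDiff_jet j s
  have e1 := edist_jet_lt_top (k := k) (f := fun _ => 0) contDiff_const zero_le_one
  have e2 := edist_jet_lt_top (k := k) hf zero_le_one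
  rw [jet_zero, jet_zero, vertical_zero_zero] at e1
  rw [h0, h1, edist_comm] at e2
  exact (edist_triangle _ _ _).trans_lt (ENNReal.add_lt_top.mpr ⟨e1, e2⟩)

/-! ### The metric on vertical planes -/

theorem vertical_mul_vertical_zero (t : ℝ) (u v : Fin (k + 1) → ℝ) :
    vertical t u * vertical 0 v = vertical t (u + v) := by
  ext j
  · simp [mul_x, vertical]
  · simp [mul_u, vertical, taylorShift_zero]

theorem edist_vertical_add (t : ℝ) (u w : Fin (k + 1) → ℝ) :
    edist (vertical t u) (vertical t (u + w)) = edist 1 (vertical 0 w) := by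
  have h := isometry_mul_left (vertical t u) 1 (vertical 0 w)
  simpa only [mul_one, vertical_mul_vertical_zero] using h

theorem edist_vertical (t : ℝ) (u v : Fin (k + 1) → ℝ) :
    edist (vertical t u) (vertical t v) = edist 1 (vertical 0 (v - u)) := by
  rw [← edist_vertical_add t u (v - u), add_sub_cancel]

/-- Descending induction from `u_k`: as `u_j' = u_{j+1} x'` and `|x'|` is at most the speed, each
integration contributes one more factor `L`. -/
theorem abs_u_le {γ : ℝ → JetSpace k} {a b L : ℝ} (hγ : IsHorizontalCurve γ a b)
    (ha : (γ a).u = 0) (hL : 0 ≤ L) (hlen : curveLength γ a b ≤ ENNReal.ofReal L)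
    (j : Fin (k + 1)) {τ : ℝ} (hτ : τ ∈ Icc a b) : |(γ τ).u j| ≤ L ^ weight j := by
  induction j using Fin.reverseInduction generalizing τ with
  | last =>
    have h := abs_sub_le_of_deriv_le (f := fun σ => (γ σ).u (Fin.last k)) zero_le_one hL
      (hγ.ac_u _) (Filter.Eventually.of_forall fun σ => by
        rw [one_mul]
        exact abs_deriv_u_le_speed γ σ) hlen hτ
    simpa [ha, weight_last] using h
  | cast j ih =>
    have h := abs_sub_le_of_deriv_le (f := fun σ => (γ σ).u j.castSucc)
      (pow_nonneg hL (weight j.succ)) hL (hγ.ac_u _) ?_ hlen hτ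
    · simpa [ha, weight_castSucc, pow_succ] using h
    · filter_upwards [hγ.contact, ae_restrict_mem measurableSet_Icc] with σ hσ hm
      rw [hσ j, abs_mul]
      exact mul_le_mul (ih hm) (abs_deriv_x_le_speed γ σ) (abs_nonneg _) (pow_nonneg hL _)

theorem abs_sub_le_of_edist_lt {t L : ℝ} {u v : Fin (k + 1) → ℝ} (hL : 0 ≤ L)
    (h : edist (vertical t u) (vertical t v) < ENNReal.ofReal L) (j : Fin (k + 1)) :
    |u j - v j| ≤ L ^ weight j := by
  rw [edist_vertical] at h
  obtain ⟨γ, a, b, hab, hγ, ha, hb, hlt⟩ := exists_curve_of_ccDist_lt h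
  have h1 := abs_u_le hγ (by rw [ha]; rfl) hL hlt.le j (right_mem_Icc.mpr hab)
  rw [hb] at h1
  rw [abs_sub_comm]
  exact h1

/-- The dilation by `ρ = |s|^(1/w_j) ≤ r` carries the unit vector with the sign of `s` to the
required point. Dilations with `ρ ≥ 0` preserve signs, so the constant includes the distances to
both unit vectors. -/
theorem exists_edist_one_single_le (j : Fin (k + 1)) :
    ∃ C : ℝ≥0∞, C ≠ ⊤ ∧ ∀ (r s : ℝ), 0 ≤ r → |s| ≤ r ^ weight j →
      edist (1 : JetSpace k) (vertical 0 (Pi.single j s)) ≤ C * ENNReal.ofReal r := by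
  refine ⟨edist (1 : JetSpace k) (vertical 0 (Pi.single j 1))
    + edist (1 : JetSpace k) (vertical 0 (Pi.single j (-1))),
    (ENNReal.add_lt_top.mpr ⟨edist_one_single_lt_top j 1, edist_one_single_lt_top j (-1)⟩).ne,
    fun r s hr hs => ?_⟩
  set ρ : ℝ := |s| ^ ((weight j : ℝ)⁻¹) with hρ
  have hρ0 : 0 ≤ ρ := by positivity
  have hρs : ρ ^ weight j = |s| := Real.rpow_inv_natCast_pow (abs_nonneg s) (weight_pos j).ne'
  have hρr : ρ ≤ r := by
    rw [← hρs] at hs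
    exact le_of_pow_le_pow_left₀ (weight_pos j).ne' hr hs
  have hd1 : dilation ρ (1 : JetSpace k) = 1 := by
    ext i
    · exact mul_zero _
    · exact mul_zero _
  have hd : ∀ σ : ℝ, dilation ρ (vertical (k := k) 0 (Pi.single j σ))
      = vertical 0 (Pi.single j (|s| * σ)) := by
    intro σ
    ext i
    · exact mul_zero _
    · simp only [dilation, vertical]
      rcases eq_or_ne i j with rfl | hij
      · simp [hρs]
      · simp [hij]
  have key : ∀ σ : ℝ, edist (1 : JetSpace k) (vertical 0 (Pi.single j (|s| * σ)))
      ≤ edist (1 : JetSpace k) (vertical 0 (Pi.single j σ)) * ENNReal.ofReal r := by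
    intro σ
    have h := edist_dilation_le hρ0 (1 : JetSpace k) (vertical 0 (Pi.single j σ))
    rw [hd1, hd] at h
    rw [mul_comm (edist _ _)]
    exact h.trans (mul_le_mul_left (ENNReal.ofReal_le_ofReal hρr) _)
  rw [add_mul]
  rcases abs_cases s with ⟨h, -⟩ | ⟨h, -⟩
  · have h1 := key 1
    rw [h, mul_one] at h1
    exact h1.trans le_self_add
  · have h1 := key (-1)
    rw [h, neg_mul_neg, mul_one] at h1
    exact h1.trans le_add_self

/-- Change the coordinates one at a time; by left invariance each change costs only the distance
from `1` to a coordinate vector. -/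
theorem exists_edist_vertical_le (k : ℕ) :
    ∃ C : ℝ≥0∞, C ≠ ⊤ ∧ ∀ (t r : ℝ) (u v : Fin (k + 1) → ℝ), 0 ≤ r →
      (∀ j, |u j - v j| ≤ r ^ weight j) →
      edist (vertical t u) (vertical t v) ≤ C * ENNReal.ofReal r := by
  choose C hC H using exists_edist_one_single_le (k := k)
  refine ⟨∑ j, C j, ENNReal.sum_ne_top.mpr fun j _ => hC j, fun t r u v hr huv => ?_⟩
  rw [edist_vertical]
  set w := v - u with hw
  have hwj : ∀ j, |w j| ≤ r ^ weight j := fun j => by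
    rw [hw, Pi.sub_apply, abs_sub_comm]
    exact huv j
  have key : ∀ S : Finset (Fin (k + 1)),
      edist (1 : JetSpace k) (vertical 0 (∑ j ∈ S, Pi.single j (w j)))
        ≤ (∑ j ∈ S, C j) * ENNReal.ofReal r := by
    classical
    intro S
    induction S using Finset.induction_on with
    | empty => simp [vertical_zero_zero]
    | insert i S hi ih =>
      rw [Finset.sum_insert hi, Finset.sum_insert hi, add_mul]
      refine (edist_triangle _ (vertical 0 (Pi.single i (w i))) _).trans ?_
      rw [edist_vertical_add]
      exact add_le_add (H i r (w i) hr (hwj i)) ih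
  have h := key Finset.univ
  rwa [Finset.univ_sum_single] at h

/-! ### The vertical and horizontal mappings on a vertical plane -/

theorem exists_verticalMap_eq_mul_left (f : ℝ → ℝ) (t : ℝ) :
    ∃ g : JetSpace k, ∀ p ∈ verticalPlane k t, verticalMap f t p = g * p := by
  obtain ⟨c, hc⟩ : ∃ c, (jet k f 0)⁻¹ = vertical 0 c :=
    ⟨((jet k f 0)⁻¹).u, by ext j; exacts [neg_zero, rfl]⟩
  -- Since `(t, u) = (t, 0) ⊙ (0, u)`, this element sends `(t, u)` to `(t, c) ⊙ (0, u) = (t, u +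
  -- c)`.
  refine ⟨vertical t c * (vertical t 0)⁻¹, fun p hp => ?_⟩
  have hp' : p = vertical t p.u := by
    ext j
    exacts [hp, rfl]
  have hpx : p.x = t := hp
  rw [verticalMap, hpx, sub_self, hc, hp', vertical_mul_vertical_zero]
  have h1 : vertical t p.u = vertical t 0 * vertical 0 p.u := by
    rw [vertical_mul_vertical_zero, zero_add]
  rw [h1, mul_assoc, inv_mul_cancel_left, vertical_mul_vertical_zero, add_comm]

theorem dimH_verticalMap_image (f : ℝ → ℝ) {t : ℝ} {E : Set (JetSpace k)}
    (hE : E ⊆ verticalPlane k t) : dimH (verticalMap f t '' E) = dimH E := by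
  obtain ⟨g, hg⟩ := exists_verticalMap_eq_mul_left (k := k) f t
  rw [image_congr fun p hp => hg p (hE hp), (isometry_mul_left g).dimH_image]

theorem dimH_horizontalMap_image (f : ℝ → ℝ) {t : ℝ} {E : Set (JetSpace k)}
    (hE : E ⊆ verticalPlane k t) : dimH (horizontalMap f t '' E) = 0 := by
  refine dimH_subsingleton ?_
  rintro _ ⟨p, hp, rfl⟩ _ ⟨q, hq, rfl⟩
  have hp' : p.x = t := hE hp
  have hq' : q.x = t := hE hq
  rw [horizontalMap, horizontalMap, hp', hq']

end JetSpace

/-! ### Hausdorff dimension of sets parametrized by sequences of digits -/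

section Digits

variable {A X : Type*} [Fintype A] [EMetricSpace X] {Φ : (ℕ → A) → X}

theorem tendsto_const_mul_ofReal_pow {C : ℝ≥0∞} {l : ℝ} (hC : C ≠ ⊤) (hl₀ : 0 < l) (hl₁ : l < 1) :
    Filter.Tendsto (fun n : ℕ => C * ENNReal.ofReal (l ^ n)) Filter.atTop (nhds 0) := by
  have h1 := ENNReal.tendsto_ofReal (tendsto_pow_atTop_nhds_zero_of_lt_one hl₀.le hl₁)
  have h2 := ENNReal.Tendsto.const_mul (a := C) h1 (Or.inr hC)
  simpa using h2

/-- With the discrete topology on the finite alphabet the sequence space is compact, and the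
estimate on cylinders makes `Φ` continuous. -/
theorem isCompact_range_of_digits {C : ℝ≥0∞} {l : ℝ} (hC : C ≠ ⊤) (hl₀ : 0 < l) (hl₁ : l < 1)
    (H : ∀ (n : ℕ) (a a' : ℕ → A), (∀ i < n, a i = a' i) →
      edist (Φ a) (Φ a') ≤ C * ENNReal.ofReal (l ^ n)) : IsCompact (range Φ) := by
  let _ : TopologicalSpace A := ⊥
  have : DiscreteTopology A := ⟨rfl⟩
  refine isCompact_range (continuous_iff_continuousAt.mpr fun a => ?_)
  refine EMetric.tendsto_nhds.mpr fun ε hε => ?_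
  obtain ⟨n, hn⟩ := ((tendsto_const_mul_ofReal_pow hC hl₀ hl₁).eventually_lt_const hε).exists
  have hnear : ∀ᶠ a' in nhds a, ∀ i ∈ Finset.range n, a' i = a i := by
    refine (Finset.eventually_all _).mpr fun i _ => ?_
    exact (continuous_apply i).continuousAt.eventually_mem
      ((isOpen_discrete {a i}).mem_nhds rfl)
  filter_upwards [hnear] with a' ha'
  exact (H n a' a fun i hi => ha' i (Finset.mem_range.mpr hi)).trans_lt hn

/-- The `|A|^n` cylinders of length `n` cover the range and have diameter at most `C l^n`; their
`β`-sum is at most `C^β (|A| l^β)^n ≤ C^β`. -/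
theorem dimH_range_le_of_digits {C : ℝ≥0∞} {l β : ℝ} (hC : C ≠ ⊤) (hl₀ : 0 < l) (hl₁ : l < 1)
    (hβ : 0 ≤ β) (hA : Fintype.card A * l ^ β ≤ 1)
    (H : ∀ (n : ℕ) (a a' : ℕ → A), (∀ i < n, a i = a' i) →
      edist (Φ a) (Φ a') ≤ C * ENNReal.ofReal (l ^ n)) :
    dimH (range Φ) ≤ ENNReal.ofReal β := by
  borelize X
  refine dimH_le_of_hausdorffMeasure_ne_top (d := β.toNNReal) ?_
  rw [Real.coe_toNNReal β hβ]
  have hdiam : ∀ (n : ℕ) (w : Fin n → A),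
      Metric.ediam (Φ '' {a | ∀ i : Fin n, a i = w i}) ≤ C * ENNReal.ofReal (l ^ n) := by
    intro n w
    refine Metric.ediam_le ?_
    rintro _ ⟨a, ha, rfl⟩ _ ⟨a', ha', rfl⟩
    exact H n a a' fun i hi => (ha ⟨i, hi⟩).trans (ha' ⟨i, hi⟩).symm
  have h := Measure.hausdorffMeasure_le_liminf_sum (ι := fun n : ℕ => Fin n → A) β (range Φ) _
    (tendsto_const_mul_ofReal_pow hC hl₀ hl₁)
    (fun n w => Φ '' {a | ∀ i : Fin n, a i = w i})
    (Filter.Eventually.of_forall hdiam)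
    (Filter.Eventually.of_forall fun n => by
      rintro _ ⟨a, rfl⟩
      exact mem_iUnion.mpr ⟨fun i => a i, a, fun _ => rfl, rfl⟩)
  refine ne_top_of_le_ne_top (ENNReal.rpow_ne_top_of_nonneg hβ hC) (h.trans ?_)
  refine Filter.liminf_le_of_frequently_le' (Filter.Frequently.of_forall fun n => ?_)
  calc ∑ w : Fin n → A, Metric.ediam (Φ '' {a | ∀ i : Fin n, a i = w i}) ^ β
      ≤ ∑ _w : Fin n → A, (C * ENNReal.ofReal (l ^ n)) ^ β :=
        Finset.sum_le_sum fun w _ => ENNReal.rpow_le_rpow (hdiam n w) hβ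
    _ = C ^ β * ENNReal.ofReal ((Fintype.card A * l ^ β) ^ n) := by
        rw [Finset.sum_const, Finset.card_univ, Fintype.card_fun, Fintype.card_fin, nsmul_eq_mul,
          ENNReal.mul_rpow_of_nonneg _ _ hβ, ENNReal.ofReal_rpow_of_nonneg (by positivity) hβ,
          mul_pow, ENNReal.ofReal_mul (by positivity), ← Real.rpow_natCast_mul hl₀.le,
          ← Real.rpow_mul_natCast hl₀.le, mul_comm (n : ℝ) β,
          ENNReal.ofReal_pow (Nat.cast_nonneg _), ENNReal.ofReal_natCast]
        push_cast
        ring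
    _ ≤ C ^ β := by
        refine mul_le_of_le_one_right' (ENNReal.ofReal_le_one.mpr ?_)
        exact pow_le_one₀ (by positivity) hA

/-- Reading the digit sequence as an expansion in base `|A|` gives a `β`-Hölder map from the range
onto `[0, 1]`, so `1 ≤ dimH (range Φ) / β`. -/
theorem le_dimH_range_of_digits {c l β : ℝ} (hc : 0 < c) (hl₀ : 0 < l) (hβ : 0 < β)
    (hA : 1 ≤ Fintype.card A * l ^ β) (hcard : 1 < Fintype.card A)
    (H : ∀ (n : ℕ) (a a' : ℕ → A), (∀ i < n, a i = a' i) → a n ≠ a' n →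
      ENNReal.ofReal (c * l ^ n) ≤ edist (Φ a) (Φ a')) :
    ENNReal.ofReal β ≤ dimH (range Φ) := by
  classical
  have hfirst : ∀ a a' : ℕ → A, a ≠ a' → ∃ n, (∀ i < n, a i = a' i) ∧ a n ≠ a' n := by
    intro a a' hne
    have hex : ∃ n, a n ≠ a' n := Function.ne_iff.mp hne
    exact ⟨Nat.find hex, fun i hi => not_not.mp (Nat.find_min hex hi), Nat.find_spec hex⟩
  have hinj : Function.Injective Φ := by
    intro a a' heq
    by_contra hne
    obtain ⟨n, h1, h2⟩ := hfirst a a' hne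
    have h3 := H n a a' h1 h2
    rw [heq, edist_self, nonpos_iff_eq_zero, ENNReal.ofReal_eq_zero] at h3
    exact absurd h3 (not_le.mpr (by positivity))
  have : Nonempty A := Fintype.card_pos_iff.mp (by omega)
  let e := Fintype.equivFin A
  let g : X → ℝ := fun p => Real.ofDigits fun i => e (Function.invFun Φ p i)
  have hg : ∀ a, g (Φ a) = Real.ofDigits fun i => e (a i) := fun a => by
    simp only [g, Function.leftInverse_invFun hinj a]
  have hholder : HolderOnWith (c⁻¹ ^ β).toNNReal β.toNNReal g (range Φ) := by
    rintro _ ⟨a, rfl⟩ _ ⟨a', rfl⟩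
    rcases eq_or_ne a a' with rfl | hne
    · simp
    obtain ⟨n, h1, h2⟩ := hfirst a a' hne
    rw [hg, hg, edist_dist, Real.dist_eq, Real.coe_toNNReal β hβ.le]
    have h3 := Real.abs_ofDigits_sub_ofDigits_le (x := fun i => e (a i)) (y := fun i => e (a' i))
      (n := n) fun i hi => by simp only [h1 i hi]
    have hpos : (0 : ℝ) < Fintype.card A := by exact_mod_cast (by omega : 0 < Fintype.card A)
    -- Sequences first differing at `n` have images in `[0, 1]` at most `|A|^(-n)` apart, and `1 ≤
    -- |A| l^β` bounds this by `(l^n)^β`.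
    have h4 : ((Fintype.card A : ℝ) ^ n)⁻¹ ≤ c⁻¹ ^ β * (c * l ^ n) ^ β := by
      rw [← Real.mul_rpow (by positivity) (by positivity), inv_mul_cancel_left₀ hc.ne',
        ← Real.rpow_natCast_mul hl₀.le, mul_comm, Real.rpow_mul_natCast hl₀.le, ← inv_pow]
      refine pow_le_pow_left₀ (by positivity) ?_ n
      rw [inv_le_iff_one_le_mul₀' hpos]
      exact hA
    calc ENNReal.ofReal |Real.ofDigits (fun i => e (a i)) - Real.ofDigits (fun i => e (a' i))|
        ≤ ENNReal.ofReal (c⁻¹ ^ β * (c * l ^ n) ^ β) :=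
          ENNReal.ofReal_le_ofReal (h3.trans (by simpa using h4))
      _ = ENNReal.ofReal (c⁻¹ ^ β) * ENNReal.ofReal (c * l ^ n) ^ β := by
          rw [ENNReal.ofReal_mul (by positivity),
            ENNReal.ofReal_rpow_of_nonneg (by positivity) hβ.le]
      _ ≤ _ := mul_le_mul_right (ENNReal.rpow_le_rpow (H n a a' h1 h2) hβ.le) _
  have himage : Icc (0 : ℝ) 1 ⊆ g '' range Φ := by
    intro y hy
    obtain ⟨d, -, rfl⟩ := Real.ofDigits_SurjOn hcard hy
    exact ⟨Φ fun i => e.symm (d i), mem_range_self _, by simp [hg]⟩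
  have h1 : dimH (Icc (0 : ℝ) 1) = 1 := by
    have := Real.dimH_of_mem_nhds (Icc_mem_nhds (show (0 : ℝ) < 1 / 2 by norm_num)
      (show (1 / 2 : ℝ) < 1 by norm_num))
    simpa using this
  have h2 := h1.symm.le.trans ((dimH_mono himage).trans
    (hholder.dimH_image_le (Real.toNNReal_pos.mpr hβ)))
  have h3 := ENNReal.mul_le_of_le_div h2
  rwa [one_mul] at h3

end Digits

/-! ### Digit expansions in a real base -/

/-- The number `∑ a_i ρ^(i+1)` with digits `a_0, a_1, …`. -/
noncomputable def digitSum (ρ : ℝ) (a : ℕ → ℕ) : ℝ := ∑' i, (a i : ℝ) * ρ ^ (i + 1)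

section DigitSum

variable {ρ : ℝ} {M : ℕ}

theorem digit_term_le (hρ₀ : 0 < ρ) {a : ℕ → ℕ} (ha : ∀ i, a i < M) (i : ℕ) :
    (a i : ℝ) * ρ ^ (i + 1) ≤ ((M : ℝ) - 1) * ρ * ρ ^ i := by
  have h : (a i : ℝ) + 1 ≤ M := by exact_mod_cast ha i
  rw [pow_succ', ← mul_assoc]
  have : (a i : ℝ) ≤ M - 1 := by linarith
  gcongr

theorem summable_digitSum (hρ₀ : 0 < ρ) (hρ₁ : ρ < 1) {a : ℕ → ℕ} (ha : ∀ i, a i < M) :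
    Summable fun i => (a i : ℝ) * ρ ^ (i + 1) :=
  Summable.of_nonneg_of_le (fun i => by positivity) (digit_term_le hρ₀ ha)
    ((summable_geometric_of_lt_one hρ₀.le hρ₁).mul_left _)

theorem digitSum_nonneg (hρ₀ : 0 < ρ) (a : ℕ → ℕ) : 0 ≤ digitSum ρ a :=
  tsum_nonneg fun i => by positivity

/-- The geometric series gives `(M - 1) ρ / (1 - ρ)`, which is at most `M ρ` exactly because `M ρ ≤
1`. -/
theorem digitSum_le (hρ₀ : 0 < ρ) (hρ₁ : ρ < 1) (hM : M * ρ ≤ 1) {a : ℕ → ℕ}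
    (ha : ∀ i, a i < M) : digitSum ρ a ≤ M * ρ := by
  have h := (summable_digitSum hρ₀ hρ₁ ha).tsum_le_tsum (digit_term_le hρ₀ ha)
    ((summable_geometric_of_lt_one hρ₀.le hρ₁).mul_left _)
  rw [tsum_mul_left, tsum_geometric_of_lt_one hρ₀.le hρ₁] at h
  refine h.trans ?_
  rw [← div_eq_mul_inv, div_le_iff₀ (by linarith)]
  nlinarith

theorem digitSum_succ (hρ₀ : 0 < ρ) (hρ₁ : ρ < 1) {a : ℕ → ℕ} (ha : ∀ i, a i < M) :
    digitSum ρ a = ρ * (a 0 + digitSum ρ fun i => a (i + 1)) := by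
  rw [digitSum, (summable_digitSum hρ₀ hρ₁ ha).tsum_eq_zero_add, mul_add, digitSum,
    ← tsum_mul_left]
  congr 1
  · ring
  · exact tsum_congr fun i => by ring

theorem abs_digitSum_sub_le (hρ₀ : 0 < ρ) (hρ₁ : ρ < 1) (hM : M * ρ ≤ 1) (n : ℕ)
    {a a' : ℕ → ℕ} (ha : ∀ i, a i < M) (ha' : ∀ i, a' i < M) (h : ∀ i < n, a i = a' i) :
    |digitSum ρ a - digitSum ρ a'| ≤ ρ ^ n := by
  induction n generalizing a a' with
  | zero =>
    rw [pow_zero, abs_sub_le_iff]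
    constructor <;> linarith [digitSum_nonneg hρ₀ a, digitSum_nonneg hρ₀ a',
      digitSum_le hρ₀ hρ₁ hM ha, digitSum_le hρ₀ hρ₁ hM ha']
  | succ n ih =>
    rw [digitSum_succ hρ₀ hρ₁ ha, digitSum_succ hρ₀ hρ₁ ha', h 0 n.succ_pos, ← mul_sub,
      add_sub_add_left_eq_sub, abs_mul, abs_of_pos hρ₀, pow_succ']
    exact mul_le_mul_of_nonneg_left (ih (fun i => ha _) (fun i => ha' _)
      fun i hi => h _ (Nat.succ_lt_succ hi)) hρ₀.le

/-- After removing the common prefix, the leading digits differ by at least `1`, while both tails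
lie in `[0, M ρ]`. The bound is positive only if `M ρ < 1`. -/
theorem le_abs_digitSum_sub (hρ₀ : 0 < ρ) (hρ₁ : ρ < 1) (hM : M * ρ ≤ 1) (n : ℕ)
    {a a' : ℕ → ℕ} (ha : ∀ i, a i < M) (ha' : ∀ i, a' i < M) (h : ∀ i < n, a i = a' i)
    (hn : a n ≠ a' n) :
    ρ ^ (n + 1) * (1 - M * ρ) ≤ |digitSum ρ a - digitSum ρ a'| := by
  induction n generalizing a a' with
  | zero =>
    rw [digitSum_succ hρ₀ hρ₁ ha, digitSum_succ hρ₀ hρ₁ ha', ← mul_sub, abs_mul, abs_of_pos hρ₀,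
      zero_add, pow_one]
    refine mul_le_mul_of_nonneg_left ?_ hρ₀.le
    have b1 := digitSum_nonneg hρ₀ fun i => a (i + 1)
    have b2 := digitSum_nonneg hρ₀ fun i => a' (i + 1)
    have b3 := digitSum_le hρ₀ hρ₁ hM fun i => ha (i + 1)
    have b4 := digitSum_le hρ₀ hρ₁ hM fun i => ha' (i + 1)
    rcases lt_or_gt_of_ne hn with h0 | h0
    · have h1 : (a 0 : ℝ) + 1 ≤ a' 0 := by exact_mod_cast h0
      rw [abs_sub_comm]
      refine le_trans ?_ (le_abs_self _)
      linarith
    · have h1 : (a' 0 : ℝ) + 1 ≤ a 0 := by exact_mod_cast h0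
      refine le_trans ?_ (le_abs_self _)
      linarith
  | succ n ih =>
    rw [digitSum_succ hρ₀ hρ₁ ha, digitSum_succ hρ₀ hρ₁ ha', h 0 n.succ_pos, ← mul_sub,
      add_sub_add_left_eq_sub, abs_mul, abs_of_pos hρ₀, pow_succ', mul_assoc]
    exact mul_le_mul_of_nonneg_left (ih (fun i => ha _) (fun i => ha' _)
      (fun i hi => h _ (Nat.succ_lt_succ hi)) hn) hρ₀.le

theorem ofDigits_eq_digitSum (d : ℕ → Fin M) :
    Real.ofDigits d = digitSum (M : ℝ)⁻¹ fun i => d i := by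
  simp only [Real.ofDigits, Real.ofDigitsTerm, digitSum, inv_pow]

end DigitSum

namespace JetSpace

variable {k : ℕ}

/-! ### Anisotropic Cantor sets in vertical planes -/

/-- The point of `{x = t}` whose coordinate `u_j` has the digits `a_0 j, a_1 j, …` in the base
`l ^ weight j`. -/
noncomputable def cantorPoint (t l : ℝ) (a : ℕ → ∀ j : Fin (k + 1), Fin (2 ^ weight j)) :
    JetSpace k :=
  vertical t fun j => digitSum (l ^ weight j) fun i => a i j

theorem two_pow_mul_pow_le_one {l : ℝ} (hl₀ : 0 < l) (hl₁ : l ≤ 1 / 2) (j : Fin (k + 1)) :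
    ((2 ^ weight j : ℕ) : ℝ) * l ^ weight j ≤ 1 := by
  push_cast
  rw [← mul_pow]
  exact pow_le_one₀ (by positivity) (by linarith)

theorem pow_weight_lt_one {l : ℝ} (hl₀ : 0 < l) (hl₁ : l ≤ 1 / 2) (j : Fin (k + 1)) :
    l ^ weight j < 1 :=
  pow_lt_one₀ hl₀.le (by linarith) (weight_pos j).ne'

/-- Agreement of the first `n` digits bounds the difference in `u_j` by `(l^(w_j))^n = (l^n)^(w_j)`,
the same scale `l^n` for all coordinates. -/
theorem exists_edist_cantorPoint_le (k : ℕ) (t : ℝ) {l : ℝ} (hl₀ : 0 < l) (hl₁ : l ≤ 1 / 2) :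
    ∃ C : ℝ≥0∞, C ≠ ⊤ ∧ ∀ (n : ℕ) (a a' : ℕ → ∀ j : Fin (k + 1), Fin (2 ^ weight j)),
      (∀ i < n, a i = a' i) →
      edist (cantorPoint t l a) (cantorPoint t l a') ≤ C * ENNReal.ofReal (l ^ n) := by
  obtain ⟨C, hC, H⟩ := exists_edist_vertical_le k
  refine ⟨C, hC, fun n a a' h => H _ _ _ _ (by positivity) fun j => ?_⟩
  rw [← pow_mul, mul_comm n, pow_mul]
  exact abs_digitSum_sub_le (pow_pos hl₀ _) (pow_weight_lt_one hl₀ hl₁ j)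
    (two_pow_mul_pow_le_one hl₀ hl₁ j) n (fun i => (a i j).isLt) (fun i => (a' i j).isLt)
    fun i hi => by rw [h i hi]

theorem le_edist_cantorPoint (t : ℝ) {l : ℝ} (hl₀ : 0 < l) (hl₁ : l < 1 / 2) (n : ℕ)
    (a a' : ℕ → ∀ j : Fin (k + 1), Fin (2 ^ weight j)) (h : ∀ i < n, a i = a' i)
    (hn : a n ≠ a' n) :
    ENNReal.ofReal (l * (1 - 2 * l) / 2 * l ^ n)
      ≤ edist (cantorPoint t l a) (cantorPoint t l a') := by
  obtain ⟨j, hj⟩ := Function.ne_iff.mp hn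
  have hb : 0 < 1 - 2 * l := by linarith
  -- In a coordinate of weight `w` whose `n`-th digits differ, a smaller distance would force `1 -
  -- (2l)^w ≤ ((1 - 2l)/2)^w`. But the left side is at least `1 - 2l` and the right side at most
  -- half of that.
  by_contra! hlt
  have h1 := abs_sub_le_of_edist_lt (by positivity) hlt j
  have h2 := le_abs_digitSum_sub (pow_pos hl₀ _) (pow_weight_lt_one hl₀ hl₁.le j)
    (two_pow_mul_pow_le_one hl₀ hl₁.le j) n (fun i => (a i j).isLt) (fun i => (a' i j).isLt)
    (fun i hi => by rw [h i hi]) fun heq => hj (Fin.ext heq)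
  have h3 := h2.trans h1
  have hw := (weight_pos j).ne'
  push_cast at h3
  rw [← mul_pow] at h3
  have e1 : (l * (1 - 2 * l) / 2 * l ^ n) ^ weight j
      = (l ^ weight j) ^ (n + 1) * ((1 - 2 * l) / 2) ^ weight j := by
    rw [← pow_mul, mul_comm (weight j), pow_mul, ← mul_pow]
    ring
  rw [e1] at h3
  have h4 := le_of_mul_le_mul_left h3 (by positivity)
  have h5 : ((1 - 2 * l) / 2) ^ weight j ≤ (1 - 2 * l) / 2 :=
    pow_le_of_le_one (by positivity) (by linarith) hw
  have h6 : (2 * l) ^ weight j ≤ 2 * l := pow_le_of_le_one (by positivity) (by linarith) hw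
  linarith

/-- For `l = 1/2` the bases are `2^(-w_j)` with all `2^(w_j)` digits, so every point of the unit box
has an expansion; for smaller `l` the coordinates still lie in `[0, 1]`. -/
theorem range_cantorPoint_subset (t : ℝ) {l : ℝ} (hl₀ : 0 < l) (hl₁ : l ≤ 1 / 2) :
    range (cantorPoint (k := k) t l) ⊆ range (cantorPoint t (1 / 2)) := by
  rintro _ ⟨a, rfl⟩
  have hex : ∀ j : Fin (k + 1), ∃ d : ℕ → Fin (2 ^ weight j),
      Real.ofDigits d = digitSum (l ^ weight j) fun i => a i j := by
    intro j
    have hmem : digitSum (l ^ weight j) (fun i => a i j) ∈ Icc (0 : ℝ) 1 :=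
      ⟨digitSum_nonneg (pow_pos hl₀ _) _,
        (digitSum_le (pow_pos hl₀ _) (pow_weight_lt_one hl₀ hl₁ j)
          (two_pow_mul_pow_le_one hl₀ hl₁ j) fun i => (a i j).isLt).trans
          (two_pow_mul_pow_le_one hl₀ hl₁ j)⟩
    obtain ⟨d, -, hd⟩ := Real.ofDigits_SurjOn (Nat.one_lt_two_pow (weight_pos j).ne') hmem
    exact ⟨d, hd⟩
  choose d hd using hex
  refine ⟨fun i j => d j i, ?_⟩
  unfold cantorPoint
  congr 1
  funext j
  rw [← hd j, ofDigits_eq_digitSum]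
  push_cast
  rw [one_div, inv_pow]

theorem card_digits (k : ℕ) : (Fintype.card (∀ j : Fin (k + 1), Fin (2 ^ weight j)) : ℝ)
    = 2 ^ (((k : ℝ) + 1) * ((k : ℝ) + 2) / 2) := by
  rw [Fintype.card_pi, ← sum_weight, Real.rpow_sum_of_pos two_pos]
  simp

theorem one_lt_card_digits (k : ℕ) :
    1 < Fintype.card (∀ j : Fin (k + 1), Fin (2 ^ weight j)) := by
  have h : (1 : ℝ) < Fintype.card (∀ j : Fin (k + 1), Fin (2 ^ weight j)) := by
    rw [card_digits]
    exact Real.one_lt_rpow one_lt_two (by positivity)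
  exact_mod_cast h

/-- The ratio for which the Cantor set has dimension `β`. -/
noncomputable def cantorRatio (k : ℕ) (β : ℝ) : ℝ :=
  2 ^ (-((((k : ℝ) + 1) * ((k : ℝ) + 2) / 2) / β))

theorem cantorRatio_pos (k : ℕ) (β : ℝ) : 0 < cantorRatio k β := by
  unfold cantorRatio
  positivity

theorem card_digits_mul_cantorRatio_rpow (k : ℕ) {β : ℝ} (hβ : 0 < β) :
    Fintype.card (∀ j : Fin (k + 1), Fin (2 ^ weight j)) * cantorRatio k β ^ β = 1 := by
  rw [card_digits, cantorRatio, ← Real.rpow_mul two_pos.le, ← Real.rpow_add two_pos, neg_mul,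
    div_mul_cancel₀ _ hβ.ne', add_neg_cancel, Real.rpow_zero]

theorem cantorRatio_le_half {β : ℝ} (hβ : 0 < β)
    (hβ₁ : β ≤ ((k : ℝ) + 1) * ((k : ℝ) + 2) / 2) : cantorRatio k β ≤ 1 / 2 := by
  rw [one_div, ← Real.rpow_neg_one, cantorRatio]
  refine Real.rpow_le_rpow_of_exponent_le one_le_two (neg_le_neg ?_)
  rwa [one_le_div hβ]

theorem cantorRatio_lt_half {β : ℝ} (hβ : 0 < β)
    (hβ₁ : β < ((k : ℝ) + 1) * ((k : ℝ) + 2) / 2) : cantorRatio k β < 1 / 2 := by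
  rw [one_div, ← Real.rpow_neg_one, cantorRatio]
  refine Real.rpow_lt_rpow_of_exponent_lt one_lt_two (neg_lt_neg ?_)
  rwa [one_lt_div hβ]

theorem cantorRatio_self (k : ℕ) :
    cantorRatio k (((k : ℝ) + 1) * ((k : ℝ) + 2) / 2) = 1 / 2 := by
  rw [cantorRatio, div_self (by positivity), Real.rpow_neg_one, one_div]

theorem dimH_range_cantorPoint (t : ℝ) {β : ℝ} (hβ : 0 < β)
    (hβ₁ : β ≤ ((k : ℝ) + 1) * ((k : ℝ) + 2) / 2) :
    dimH (range (cantorPoint (k := k) t (cantorRatio k β))) = ENNReal.ofReal β := by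
  have hlower : ∀ b : ℝ, 0 < b → b < ((k : ℝ) + 1) * ((k : ℝ) + 2) / 2 →
      ENNReal.ofReal b ≤ dimH (range (cantorPoint (k := k) t (cantorRatio k b))) := by
    intro b hb hb₁
    have hr := cantorRatio_lt_half hb hb₁
    have hr' : 0 < 1 - 2 * cantorRatio k b := by linarith
    have hr₀ := cantorRatio_pos k b
    exact le_dimH_range_of_digits (by positivity) hr₀ hb
      (card_digits_mul_cantorRatio_rpow k hb).ge (one_lt_card_digits k)
      (le_edist_cantorPoint t hr₀ hr)
  have hr := cantorRatio_le_half hβ hβ₁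
  refine le_antisymm ?_ ?_
  · obtain ⟨C, hC, H⟩ := exists_edist_cantorPoint_le k t (cantorRatio_pos k β) hr
    exact dimH_range_le_of_digits hC (cantorRatio_pos k β) (by linarith) hβ.le
      (card_digits_mul_cantorRatio_rpow k hβ).le H
  · rcases hβ₁.lt_or_eq with hlt | rfl
    · exact hlower β hβ hlt
    · rw [cantorRatio_self]
      -- The separation constant vanishes at ratio `1/2`. The box contains the Cantor set of every
      -- dimension `c` strictly between `0` and the top value, so its dimension is at least each
      -- such `c`.
      refine le_of_forall_lt_imp_le_of_dense fun c hc => ?_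
      have hctop : c ≠ ⊤ := ne_top_of_lt hc
      rcases eq_or_ne c 0 with rfl | hc0
      · exact zero_le
      have hcpos : 0 < c.toReal := ENNReal.toReal_pos hc0 hctop
      have hclt := (ENNReal.lt_ofReal_iff_toReal_lt hctop).mp hc
      rw [← ENNReal.ofReal_toReal hctop]
      exact (hlower _ hcpos hclt).trans (dimH_mono
        (range_cantorPoint_subset t (cantorRatio_pos k _) (cantorRatio_le_half hcpos hclt.le)))

theorem exists_isCompact_dimH_eq (k : ℕ) (t : ℝ) {β : ℝ} (hβ₀ : 0 ≤ β)
    (hβ₁ : β ≤ ((k : ℝ) + 1) * ((k : ℝ) + 2) / 2) :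
    ∃ E : Set (JetSpace k), IsCompact E ∧ E ⊆ verticalPlane k t ∧
      dimH E = ENNReal.ofReal β := by
  rcases hβ₀.eq_or_lt with rfl | hβ
  -- At `β = 0` the convention `x / 0 = 0` would make the ratio `1`, so a single point is used
  -- instead.
  · refine ⟨{vertical t 0}, isCompact_singleton, singleton_subset_iff.mpr rfl, ?_⟩
    rw [dimH_singleton, ENNReal.ofReal_zero]
  · have hr := cantorRatio_le_half hβ hβ₁
    obtain ⟨C, hC, H⟩ := exists_edist_cantorPoint_le k t (cantorRatio_pos k β) hr
    refine ⟨range (cantorPoint t (cantorRatio k β)),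
      isCompact_range_of_digits hC (cantorRatio_pos k β) (by linarith) H, ?_,
      dimH_range_cantorPoint t hβ hβ₁⟩
    rintro _ ⟨a, rfl⟩
    rfl

end JetSpace

theorem mainTheorem3 (k : ℕ) (hk : 1 ≤ k) (t β : ℝ) (hβ₀ : 0 ≤ β)
    (hβ₁ : β ≤ ((k : ℝ) + 1) * ((k : ℝ) + 2) / 2) :
    ∃ E : Set (JetSpace k), IsCompact E ∧ E ⊆ JetSpace.verticalPlane k t ∧
      ∀ f : ℝ → ℝ, ContDiff ℝ ∞ f →
        dimH (JetSpace.verticalMap f t '' E) = ENNReal.ofReal β ∧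
        dimH (JetSpace.horizontalMap f t '' E) = 0 := by
  obtain ⟨E, hE, hsub, hdim⟩ := JetSpace.exists_isCompact_dimH_eq k t hβ₀ hβ₁
  exact ⟨E, hE, hsub, fun f _ =>
    ⟨(JetSpace.dimH_verticalMap_image f hsub).trans hdim,
      JetSpace.dimH_horizontalMap_image f hsub⟩⟩
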